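/- **Definitions.** A *quantum set* $\mathcal X$ is given by a set $\mathrm{At}(\mathcal X)$ of nonzero finite-dimensional complex Hilbert spaces, its *atoms*; $\mathcal X$ is nonempty if it has at least one atom. An ordinary set $S$ is identified with the quantum set $`S$ having one one-dimensional atom $\mathbb C_s$ for each $s\in S$; for a nonzero finite-dimensional Hilbert space $H$, $\mathcal Q\{H\}$ is the quantum set whose only atom is $H$. The atoms of $\mathcal X\times\mathcal Y$ are the $X\otimes Y$ with $X\in \mathrm{At}(\mathcal X)$, $Y\in\mathrm{At}(\mathcal Y)$. A *binary relation* $R$ from $\mathcal X$ to $\mathcal Y$ assigns to each pair of atoms a subspace $R(X,Y)\le L(X,Y)$. Relations are ordered atomwise; $(S\circ R)(X,Z)$ is the span of all $sr$ with $s\in S(Y,Z)$, $r\in R(X,Y)$, $Y\in\mathrm{At}(\mathcal Y)$; $R^\dagger(Y,X)=\{r^\dagger \mid r\in R(X,Y)\}$; $I_{\mathcal X}(X,X)=\mathbb C 1_X$ and $I_{\mathcal X}(X,X')=0$ for $X\ne X'$; $(R_1\times R_2)(X_1\otimes X_2,Y_1\otimes Y_2)$ is the span of all $r_1\otimes r_2$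 with $r_i\in R_i(X_i,Y_i)$. A *function* $F:\mathcal X\to\mathcal Y$ is a relation with $F^\dagger\circ F\ge I_{\mathcal X}$ and $F\circ F^\dagger\le I_{\mathcal Y}$; an ordinary function $f:S\to T$ yields a function $`f:{`S}\to{`T}$. A *predicate* on $\mathcal X$ assigns to each atom $X$ a subspace $P(X)\le X$; $P$ and $Q$ are *disjoint* if $P(X)\perp Q(X)$ for every atom $X$. For $t \in T$, $`\{t\}$ is the predicate on $`T$ that is $\mathbb C_t$ at $t$ and $0$ at the other atoms. The *inverse image* of a predicate $Q$ under $R$ is given by $R^\star(Q)(X)=\mathrm{span}\{r^\dagger y \mid Y\in\mathrm{At}(\mathcal Y),\ r\in R(X,Y),\ y\in Q(Y)\}$. Let $G$ be a simple graph and $T$ a set of colors (either may be infinite). A *quantum family of graph colorings* of $G$ indexed by $\mathcal X$ is a function $F:{`G}\times\mathcal X\to{`T}$ such that for all adjacent vertices $g_1,g_2$ and every $t\in T$ the predicates $F_{g_1}^\star(`\{t\})$ and $F_{g_2}^\star(`\{t\})$ on $\mathcal X$ are disjoint, where $F_g=F\circ(`\mathrm{cst}_g\times I_{\mathcal X}):\mathcal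 X\cong {`\{*\}}\times\mathcal X\to{`T}$ and $\mathrm{cst}_g:\{*\}\to G$ has value $g$. In the *graph coloring game*, two players who cannot communicate are asked vertices $g_1,g_2$ and answer with colors $t_1,t_2$; they win unless $g_1=g_2$ and $t_1\neq t_2$, or $g_1,g_2$ are adjacent and $t_1=t_2$. An *entangled quantum strategy* consists of finite-dimensional Hilbert spaces $A,B$, a unit vector $\psi\in A\otimes B$, and, for each vertex $g$, measurements $(E_{gt})_{t\in T}$ on $A$ and $(E'_{gt})_{t\in T}$ on $B$ (positive operators with $\sum_t E_{gt}=1_A$, $\sum_t E'_{gt}=1_B$); the answers $t_1,t_2$ to $g_1,g_2$ then have probability $\langle\psi|(E_{g_1t_1}\otimes E'_{g_2t_2})\psi\rangle$. It is *winning* if, for every pair of questions, every losing pair of answers has probability $0$. **Proposition.** For every simple graph $G$ and every set $T$, the following are equivalent: 1. the graph coloring game has a winning entangled quantum strategy; 2. there is a quantum family of graph colorings indexed by some nonempty quantum set $\mathcal X$; 3. there is a quantum family of graph colorings indexed by $\mathcal Q\{H\}$ for some nonzero finite-dimensional Hilbert space $H$. Moreover, for each nonzero finite-dimensional Hilbert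 space $H$, assigning to $F$ the orthogonal projections $p_{gt}$ of $H$ onto $F_g^\star(`\{t\})(H)$ is a bijection from the quantum families of graph colorings indexed by $\mathcal Q\{H\}$ onto the families $(p_{gt})_{g\in G,\,t\in T}$ of projections in $L(H)$ such that $\sum_{t\in T}p_{gt}=1_H$ for each vertex $g$, and $p_{g_1t}\,p_{g_2t}=0$ for each $t\in T$ and all adjacent vertices $g_1,g_2$. -/

import Mathlib

open scoped TensorProduct

universe u₁ u₂ u₃ v₁ v₂ v₃ w₁ w₂

noncomputable section

/-- A quantum set: a set of atoms, each of which is a nonzero finite-dimensional complex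
Hilbert space. The atoms are indexed by a type, whose equality is the identity of atoms
(two distinct atoms may be isometric as Hilbert spaces). -/
structure QuantumSet where
  Atom : Type u₁
  space : Atom → Type v₁
  [instGroup : ∀ x, NormedAddCommGroup (space x)]
  [instInner : ∀ x, InnerProductSpace ℂ (space x)]
  [instFinite : ∀ x, FiniteDimensional ℂ (space x)]
  [instNontrivial : ∀ x, Nontrivial (space x)]

namespace QuantumSet

attribute [instance] instGroup instInner instFinite instNontrivial

/-- The quantum set of an ordinary set `S`: one one-dimensional atom for each element of `S`. -/
@[reducible] def ofType (S : Type u₁) : QuantumSet.{u₁, 0} where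
  Atom := S
  space := fun _ => ℂ

/-- The quantum set whose only atom is the Hilbert space `H`. -/
@[reducible] def atomic (H : Type v₁) [NormedAddCommGroup H] [InnerProductSpace ℂ H]
    [FiniteDimensional ℂ H] [Nontrivial H] : QuantumSet.{0, v₁} where
  Atom := Unit
  space := fun _ => H

/-- The Cartesian product: the atoms are the tensor products of atoms of the two factors. -/
@[reducible] def prod (X : QuantumSet.{u₁, v₁}) (Y : QuantumSet.{u₂, v₂}) :
    QuantumSet.{max u₁ u₂, max v₁ v₂} where
  Atom := X.Atom × Y.Atom
  space := fun p => X.space p.1 ⊗[ℂ] Y.space p.2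

/-- A binary relation: a subspace of operators for each pair of atoms. It is ordered atomwise. -/
abbrev Rel (X : QuantumSet.{u₁, v₁}) (Y : QuantumSet.{u₂, v₂}) :=
  ∀ (x : X.Atom) (y : Y.Atom), Submodule ℂ (X.space x →ₗ[ℂ] Y.space y)

/-- A predicate: a subspace of each atom. Predicates are ordered atomwise. -/
abbrev Pred (X : QuantumSet.{u₁, v₁}) := ∀ x : X.Atom, Submodule ℂ (X.space x)

/-- The identity relation: scalar multiples of the identity operator of each atom, and zero
between distinct atoms. -/
def Rel.id (X : QuantumSet.{u₁, v₁}) : Rel X X := fun x x' =>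
  Submodule.span ℂ {a | ∃ h : x = x', ∀ ξ, a ξ = cast (congrArg X.space h) ξ}

/-- The composition `S ∘ R`. -/
def Rel.comp {X : QuantumSet.{u₁, v₁}} {Y : QuantumSet.{u₂, v₂}} {Z : QuantumSet.{u₃, v₃}}
    (S : Rel Y Z) (R : Rel X Y) : Rel X Z := fun x z =>
  Submodule.span ℂ {a | ∃ y, ∃ s ∈ S y z, ∃ r ∈ R x y, a = s ∘ₗ r}

/-- The adjoint relation: `R†(Y, X)` consists of the Hermitian adjoints of the operators in
`R(X, Y)`. -/
def Rel.adjoint {X : QuantumSet.{u₁, v₁}} {Y : QuantumSet.{u₂, v₂}} (R : Rel X Y) : Rel Y X :=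
  fun y x => (R x y).map
    (LinearMap.adjoint : (X.space x →ₗ[ℂ] Y.space y) ≃ₗ⋆[ℂ] (Y.space y →ₗ[ℂ] X.space x)).toLinearMap

/-- The Cartesian product of two relations. -/
def Rel.prod {X₁ : QuantumSet.{u₁, v₁}} {Y₁ : QuantumSet.{u₂, v₂}}
    {X₂ : QuantumSet.{u₃, v₃}} {Y₂ : QuantumSet.{w₁, w₂}}
    (R₁ : Rel X₁ Y₁) (R₂ : Rel X₂ Y₂) : Rel (X₁.prod X₂) (Y₁.prod Y₂) := fun x y =>
  Submodule.span ℂ {a | ∃ r₁ ∈ R₁ x.1 y.1, ∃ r₂ ∈ R₂ x.2 y.2, a = TensorProduct.map r₁ r₂}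

/-- The relation between quantum sets given by an ordinary relation `r` between ordinary sets:
all operators between the atoms of related elements, and zero otherwise. -/
def Rel.ofRel {S : Type u₁} {T : Type u₂} (r : S → T → Prop) : Rel (ofType S) (ofType T) :=
  fun s t => ⨆ _ : r s t, ⊤

/-- The canonical isomorphism from `X` to `𝟏 × X`, spanned on each atom by `ξ ↦ 1 ⊗ ξ`, where
`𝟏` is the quantum set of a one-point set. -/
def Rel.leftUnitorInv (X : QuantumSet.{u₁, v₁}) : Rel X ((ofType Unit).prod X) := fun x p =>
  Submodule.span ℂ
    {a | ∃ h : x = p.2, ∀ ξ, a ξ = (1 : ℂ) ⊗ₜ[ℂ] cast (congrArg X.space h) ξ}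

/-- A relation is a function iff `F† ∘ F ≥ I` and `F ∘ F† ≤ I`. -/
def Rel.IsFunction {X : QuantumSet.{u₁, v₁}} {Y : QuantumSet.{u₂, v₂}} (F : Rel X Y) : Prop :=
  Rel.id X ≤ F.adjoint.comp F ∧ F.comp F.adjoint ≤ Rel.id Y

/-- The predicate on the quantum set of `S` given by an ordinary subset of `S`. -/
def Pred.ofSet {S : Type u₁} (p : Set S) : Pred (ofType S) := fun s => ⨆ _ : s ∈ p, ⊤

/-- The atomwise orthocomplement of a predicate. -/
def Pred.compl {X : QuantumSet.{u₁, v₁}} (P : Pred X) : Pred X := fun x => (P x)ᗮ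

/-- Two predicates are disjoint iff the first is below the orthocomplement of the second. -/
def Pred.IsDisjoint {X : QuantumSet.{u₁, v₁}} (P Q : Pred X) : Prop := P ≤ Q.compl

/-- The direct image of a predicate under a relation. -/
def Rel.directImage {X : QuantumSet.{u₁, v₁}} {Y : QuantumSet.{u₂, v₂}} (R : Rel X Y)
    (P : Pred X) : Pred Y := fun y =>
  Submodule.span ℂ {η | ∃ x, ∃ ξ ∈ P x, ∃ r ∈ R x y, η = r ξ}

/-- The inverse image of a predicate: the direct image under the adjoint relation. -/
def Rel.inverseImage {X : QuantumSet.{u₁, v₁}} {Y : QuantumSet.{u₂, v₂}} (R : Rel X Y)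
    (Q : Pred Y) : Pred X := R.adjoint.directImage Q

/-- The function `F_g = F(g, ·)`, which is `F ∘ (cst_g × I)` under the identification of
`X` with `𝟏 × X`. -/
def Rel.slice {V : Type u₁} {X : QuantumSet.{u₂, v₂}} {Y : QuantumSet.{u₃, v₃}}
    (F : Rel ((ofType V).prod X) Y) (g : V) : Rel X Y :=
  F.comp (((Rel.ofRel fun (_ : Unit) s => s = g).prod (Rel.id X)).comp (Rel.leftUnitorInv X))

/-- A quantum family of graph colorings of `G` by colors in `T`, indexed by `X`. -/
def IsColoringFamily {V : Type u₁} {T : Type u₂} (G : SimpleGraph V)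
    (X : QuantumSet.{u₃, v₃}) (F : Rel ((ofType V).prod X) (ofType T)) : Prop :=
  F.IsFunction ∧ ∀ g₁ g₂, G.Adj g₁ g₂ → ∀ t : T,
    ((F.slice g₁).inverseImage (Pred.ofSet {t})).IsDisjoint
      ((F.slice g₂).inverseImage (Pred.ofSet {t}))

/-- For a relation `F` from `V × Q{H}` to `T`, the orthogonal projection of `H` onto the subspace
that is the inverse image of the predicate `{t}` under `F_g`. -/
def colorProjection {V : Type u₁} {T : Type u₂} {H : Type v₁} [NormedAddCommGroup H]
    [InnerProductSpace ℂ H] [FiniteDimensional ℂ H] [Nontrivial H]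
    (F : Rel ((ofType V).prod (atomic H)) (ofType T)) (g : V) (t : T) : H →ₗ[ℂ] H :=
  let K : Submodule ℂ H := (F.slice g).inverseImage (Pred.ofSet {t}) ()
  (K.starProjection : H →ₗ[ℂ] H)

end QuantumSet

/-- The winning condition of the graph coloring game: if the two players are asked `g₁` and `g₂`
and answer `t₁` and `t₂`, then they win iff equal vertices received equal colors and adjacent
vertices received different colors. -/
def SimpleGraph.ColoringGameWins {V : Type u₁} {T : Type u₂} (G : SimpleGraph V)
    (g₁ g₂ : V) (t₁ t₂ : T) : Prop :=
  (g₁ = g₂ → t₁ = t₂) ∧ (G.Adj g₁ g₂ → t₁ ≠ t₂)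

/-- A measurement (POVM) on a finite-dimensional Hilbert space with outcomes in `T`: positive
operators that sum to the identity. -/
structure QuantumMeasurement (T : Type u₁) (H : Type v₁) [NormedAddCommGroup H]
    [InnerProductSpace ℂ H] [FiniteDimensional ℂ H] where
  effect : T → (H →ₗ[ℂ] H)
  isPositive : ∀ t, (effect t).IsPositive
  hasSum : ∀ ξ, HasSum (fun t => effect t ξ) ξ

/-- An entangled strategy for a two-player game with questions in `V` and answers in `T`, when
the players have quantum systems `A` and `B`: a shared pure state, and for each player and each
question a measurement of the player's own system. -/
structure EntangledStrategy (V : Type u₁) (T : Type u₂) (A : Type v₁) (B : Type v₂)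
    [NormedAddCommGroup A] [InnerProductSpace ℂ A] [FiniteDimensional ℂ A]
    [NormedAddCommGroup B] [InnerProductSpace ℂ B] [FiniteDimensional ℂ B] where
  state : A ⊗[ℂ] B
  norm_state : ‖state‖ = 1
  alice : V → QuantumMeasurement T A
  bob : V → QuantumMeasurement T B

/-- The probability of the answers `t₁`, `t₂` to the questions `g₁`, `g₂`. -/
def EntangledStrategy.prob {V : Type u₁} {T : Type u₂} {A : Type v₁} {B : Type v₂}
    [NormedAddCommGroup A] [InnerProductSpace ℂ A] [FiniteDimensional ℂ A]
    [NormedAddCommGroup B] [InnerProductSpace ℂ B] [FiniteDimensional ℂ B]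
    (σ : EntangledStrategy V T A B) (g₁ g₂ : V) (t₁ t₂ : T) : ℝ :=
  (inner ℂ σ.state
    (TensorProduct.map ((σ.alice g₁).effect t₁) ((σ.bob g₂).effect t₂) σ.state)).re

/-- A strategy is winning iff the players win with certainty, whatever the questions: every pair
of answers that has nonzero probability wins. -/
def EntangledStrategy.IsWinning {V : Type u₁} {T : Type u₂} {A : Type v₁} {B : Type v₂}
    [NormedAddCommGroup A] [InnerProductSpace ℂ A] [FiniteDimensional ℂ A]
    [NormedAddCommGroup B] [InnerProductSpace ℂ B] [FiniteDimensional ℂ B]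
    (σ : EntangledStrategy V T A B) (G : SimpleGraph V) : Prop :=
  ∀ g₁ g₂ t₁ t₂, σ.prob g₁ g₂ t₁ t₂ ≠ 0 → G.ColoringGameWins g₁ g₂ t₁ t₂

/-- Families of projections `p g t` on `H` such that `∑ t, p g t = 1` for each vertex `g`, and
`p g₁ t * p g₂ t = 0` for each color `t` whenever `g₁` and `g₂` are adjacent. -/
def IsProjectiveColoring {V : Type u₁} {T : Type u₂} {H : Type v₁} [NormedAddCommGroup H]
    [InnerProductSpace ℂ H] [FiniteDimensional ℂ H]
    (G : SimpleGraph V) (p : V → T → (H →ₗ[ℂ] H)) : Prop :=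
  (∀ g t, IsStarProjection (p g t)) ∧
  (∀ g ξ, HasSum (fun t => p g t ξ) ξ) ∧
  ∀ g₁ g₂, G.Adj g₁ g₂ → ∀ t, p g₁ t * p g₂ t = 0

end

/-! Atoms of the product of `V` and `X` have the form `ℂ ⊗ H`, so an operator from such an atom to
`ℂ` is a bra `c ⊗ ξ ↦ c ⟪v, ξ⟫`. A relation `F` is therefore the same thing as its family of
subspaces `colorSpace F g x t`. In these terms `F ∘ F† ≤ I` says that the spaces of distinct colors
are orthogonal, `F† ∘ F ≥ I` that they span, and disjointness that adjacent vertices have orthogonal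
spaces for each color. So a coloring family is a projective coloring on each atom separately
(`isColoringFamily_iff`), which gives the bijection and lets any single atom serve as `H`.

For a winning strategy with state `ψ`, the rule for equal vertices gives `(E_gt ⊗ 1)ψ = (E_gt ⊗
E'_gt)ψ = (1 ⊗ E'_gt)ψ`. Hence Alice's operators preserve the support of `ψ` in `A` and restrict to
a projective coloring there. Conversely, projections on one side and their transposes on the other
win on a maximally entangled state, by `lTensor_transposeOperator`. -/

namespace QuantumSet

/-! ### Relations into an ordinary set as families of subspaces -/

/-- The functional `c ⊗ ξ ↦ c ⟪v, ξ⟫` on the atom `ℂ ⊗ H`. -/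
noncomputable def bra {H : Type v₁} [NormedAddCommGroup H] [InnerProductSpace ℂ H] (v : H) :
    ℂ ⊗[ℂ] H →ₗ[ℂ] ℂ :=
  (innerₛₗ ℂ v) ∘ₗ (TensorProduct.lid ℂ H).toLinearMap

section Bra

variable {H : Type v₁} [NormedAddCommGroup H] [InnerProductSpace ℂ H]

@[simp] lemma bra_tmul (v ξ : H) (c : ℂ) : bra v (c ⊗ₜ[ℂ] ξ) = c * inner ℂ v ξ := by
  simp [bra, inner_smul_right]

lemma bra_add (v w : H) : bra (v + w) = bra v + bra w := by
  ext ξ; simp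

lemma bra_smul (c : ℂ) (v : H) : bra (c • v) = (starRingEnd ℂ c) • bra v := by
  ext ξ; simp [mul_comm]

lemma bra_zero : bra (0 : H) = 0 := by
  ext ξ; simp

variable [FiniteDimensional ℂ H]

lemma exists_eq_bra (f : ℂ ⊗[ℂ] H →ₗ[ℂ] ℂ) : ∃ v : H, f = bra v := by
  have := FiniteDimensional.complete ℂ H
  refine ⟨(InnerProductSpace.toDual ℂ H).symm
    (LinearMap.toContinuousLinearMap (f ∘ₗ (TensorProduct.lid ℂ H).symm.toLinearMap)), ?_⟩
  ext ξ
  simp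

lemma adjoint_bra (v : H) (c : ℂ) : LinearMap.adjoint (bra v) c = c ⊗ₜ[ℂ] v := by
  refine ext_inner_right ℂ fun z => ?_
  rw [LinearMap.adjoint_inner_left]
  induction z with
  | zero => simp
  | tmul a ξ => simp [mul_comm, mul_assoc, mul_left_comm]
  | add a b ha hb => rw [map_add, inner_add_right, inner_add_right, ha, hb]

end Bra

lemma Rel.mem_leftUnitorInv {X : QuantumSet.{u₁, v₁}} (x : X.Atom) :
    (TensorProduct.mk ℂ ℂ (X.space x) 1) ∈ Rel.leftUnitorInv X x ((), x) :=
  Submodule.subset_span ⟨rfl, fun _ => rfl⟩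

lemma Rel.id_mem_id {X : QuantumSet.{u₁, v₁}} (x : X.Atom) : LinearMap.id ∈ Rel.id X x x :=
  Submodule.subset_span ⟨rfl, fun _ => rfl⟩

lemma Rel.id_apply {X : QuantumSet.{u₁, v₁}} (x : X.Atom) :
    Rel.id X x x = Submodule.span ℂ {LinearMap.id} := by
  unfold Rel.id
  congr 1
  ext a
  simp [LinearMap.ext_iff]

lemma Rel.id_apply_of_ne {X : QuantumSet.{u₁, v₁}} {x x' : X.Atom} (h : x ≠ x') :
    Rel.id X x x' = ⊥ := by
  simp [Rel.id, h]

variable {V : Type u₁} {T : Type u₂} {X : QuantumSet.{u₃, v₃}}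

/-- Only the atom `(g, x)` contributes to the composite, up to a scalar. The nested spans are peeled
off one at a time: membership in `M` is linear in each factor, so each span is compared with a
`comap` of `M` and only generators remain. -/
lemma mem_slice {F : Rel ((ofType V).prod X) (ofType T)} {g : V} {x : X.Atom} {t : T}
    {r : X.space x →ₗ[ℂ] ℂ} :
    r ∈ F.slice g x t ↔ ∃ f ∈ F (g, x) t, r = f ∘ₗ TensorProduct.mk ℂ ℂ (X.space x) 1 := by
  let M : Submodule ℂ (X.space x →ₗ[ℂ] ℂ) :=
    (F (g, x) t).map (LinearMap.lcomp ℂ ℂ (TensorProduct.mk ℂ ℂ (X.space x) 1))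
  constructor
  · intro hr
    suffices h : F.slice g x t ≤ M by
      obtain ⟨f, hf, e⟩ := h hr
      exact ⟨f, hf, e.symm⟩
    refine Submodule.span_le.2 ?_
    rintro _ ⟨⟨g', x'⟩, s, hs, a, ha, rfl⟩
    suffices h : (((Rel.ofRel fun (_ : Unit) s => s = g).prod (Rel.id X)).comp
        (Rel.leftUnitorInv X)) x (g', x') ≤ M.comap (LinearMap.compRight ℂ s) from h ha
    refine Submodule.span_le.2 ?_
    rintro _ ⟨⟨u, x''⟩, b, hb, r, hr, rfl⟩
    suffices h : Rel.leftUnitorInv X x (u, x'') ≤ M.comap (LinearMap.compRight ℂ (s ∘ₗ b)) from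
      h hr
    refine Submodule.span_le.2 ?_
    rintro r ⟨h, hξ⟩
    obtain rfl : x = x'' := h
    suffices h : ((Rel.ofRel fun (_ : Unit) s => s = g).prod (Rel.id X)) (u, x) (g', x') ≤
        M.comap ((LinearMap.lcomp ℂ ℂ r) ∘ₗ (LinearMap.compRight ℂ s)) from h hb
    refine Submodule.span_le.2 ?_
    rintro _ ⟨r₁, h₁, r₂, h₂, rfl⟩
    change (s ∘ₗ TensorProduct.map r₁ r₂) ∘ₗ r ∈ M
    by_cases hg : g' = g
    · subst hg
      by_cases hx : x = x'
      · subst hx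
        have h₂' : r₂ ∈ Rel.id X x x := h₂
        rw [Rel.id_apply, Submodule.mem_span_singleton] at h₂'
        obtain ⟨c, rfl⟩ := h₂'
        -- An operator `r₁` on `ℂ` is multiplication by `r₁ 1`, and `r₂` is `c` times the identity.
        refine ⟨(c * r₁ (1 : ℂ)) • s, Submodule.smul_mem _ _ hs, ?_⟩
        refine LinearMap.ext fun ξ => ?_
        have e : (c * r₁ (1 : ℂ)) • ((1 : ℂ) ⊗ₜ[ℂ] ξ) = r₁ (1 : ℂ) ⊗ₜ[ℂ] (c • ξ) := by
          rw [TensorProduct.smul_tmul', TensorProduct.tmul_smul, TensorProduct.smul_tmul',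
            smul_eq_mul, smul_eq_mul, mul_one]
        have e' : TensorProduct.map r₁ (c • LinearMap.id) (r ξ) = r₁ (1 : ℂ) ⊗ₜ[ℂ] (c • ξ) :=
          (congrArg (TensorProduct.map r₁ (c • LinearMap.id)) (hξ ξ)).trans
            (TensorProduct.map_tmul _ _ _ _)
        exact (map_smul s _ _).symm.trans (congrArg s (e.trans e'.symm))
      · have h₂' : r₂ ∈ Rel.id X x x' := h₂
        rw [Rel.id_apply_of_ne hx, Submodule.mem_bot] at h₂'
        subst h₂'
        simp
    · have h₁' : r₁ = 0 := by simpa [Rel.ofRel, hg] using h₁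
      subst h₁'
      simp
  · rintro ⟨f, hf, rfl⟩
    refine Submodule.subset_span ⟨(g, x), f, hf, _, Submodule.subset_span
      ⟨((), x), TensorProduct.map LinearMap.id LinearMap.id, Submodule.subset_span
        ⟨LinearMap.id, ?_, LinearMap.id, Rel.id_mem_id x, rfl⟩, _, Rel.mem_leftUnitorInv x, rfl⟩, ?_⟩
    · simp [Rel.ofRel]
    · rw [TensorProduct.map_id]; rfl

/-- The inverse image of the color `t` under `F_g`, on the atom `x`. -/
noncomputable def colorSpace (F : Rel ((ofType V).prod X) (ofType T)) (g : V) (x : X.Atom) (t : T) :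
    Submodule ℂ (X.space x) :=
  (F.slice g).inverseImage (Pred.ofSet {t}) x

/-- For `r = ⟪w, ·⟫` one has `r† y = y • w`, and `bra` is conjugate-linear, so the vectors whose bra
lies in `F (g, x) t` already form a subspace and taking the span adds nothing. -/
lemma mem_colorSpace {F : Rel ((ofType V).prod X) (ofType T)} {g : V} {x : X.Atom} {t : T}
    {v : X.space x} : v ∈ colorSpace F g x t ↔ bra v ∈ F (g, x) t := by
  constructor
  · intro hv
    induction hv using Submodule.span_induction with
    | zero => rw [bra_zero]; exact zero_mem _
    | add a b _ _ ha hb => rw [bra_add]; exact add_mem ha hb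
    | smul c a _ ha => rw [bra_smul]; exact Submodule.smul_mem _ _ ha
    | mem v hv =>
      obtain ⟨t', y, hy, r, hr, rfl⟩ := hv
      obtain ⟨r, hr, rfl⟩ := hr
      by_cases ht : t' = t
      · subst ht
        obtain ⟨f, hf, rfl⟩ := mem_slice.1 hr
        obtain ⟨w, rfl⟩ := exists_eq_bra f
        have : bra w ∘ₗ TensorProduct.mk ℂ ℂ (X.space x) 1 = innerₛₗ ℂ w := by ext; simp
        rw [this]
        have e : LinearMap.adjoint (innerₛₗ ℂ w : X.space x →ₗ[ℂ] ℂ) y = (y : ℂ) • w := by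
          refine ext_inner_right ℂ fun z => ?_
          rw [LinearMap.adjoint_inner_left]
          simp [inner_smul_left, mul_comm]
        have := Submodule.smul_mem _ ((starRingEnd ℂ) (y : ℂ)) hf
        rw [← bra_smul, ← e] at this
        exact this
      · have hy' : y = 0 := by simpa [Pred.ofSet, ht] using hy
        subst hy'
        rw [map_zero, bra_zero]; exact zero_mem _
  · intro hv
    refine Submodule.subset_span ⟨t, (1 : ℂ), by simp [Pred.ofSet], _,
      ⟨_, mem_slice.2 ⟨_, hv, rfl⟩, rfl⟩, ?_⟩
    refine ext_inner_right ℂ fun z => ?_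
    erw [LinearMap.adjoint_inner_left]
    simp

lemma rel_ext_of_colorSpace {F F' : Rel ((ofType V).prod X) (ofType T)}
    (h : ∀ g x t, colorSpace F g x t = colorSpace F' g x t) : F = F' := by
  funext ⟨g, x⟩ t
  ext f
  obtain ⟨v, rfl⟩ := exists_eq_bra f
  rw [← mem_colorSpace, h, mem_colorSpace]

/-- The relation with prescribed color spaces. -/
noncomputable def relOfSpaces (K : V → ∀ x : X.Atom, T → Submodule ℂ (X.space x)) :
    Rel ((ofType V).prod X) (ofType T) := fun p t =>
  { carrier := {f | ∃ v ∈ K p.1 p.2 t, f = bra v}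
    zero_mem' := ⟨0, zero_mem _, bra_zero.symm⟩
    add_mem' := by
      rintro _ _ ⟨v, hv, rfl⟩ ⟨w, hw, rfl⟩
      exact ⟨v + w, add_mem hv hw, (bra_add v w).symm⟩
    smul_mem' := by
      rintro c _ ⟨v, hv, rfl⟩
      exact ⟨starRingEnd ℂ c • v, Submodule.smul_mem _ _ hv, by rw [bra_smul]; simp⟩ }

lemma bra_injective {H : Type v₁} [NormedAddCommGroup H] [InnerProductSpace ℂ H] :
    Function.Injective (bra : H → _) := fun v w h =>
  ext_inner_right ℂ fun z => by simpa using LinearMap.congr_fun h (1 ⊗ₜ z)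

lemma colorSpace_relOfSpaces (K : V → ∀ x : X.Atom, T → Submodule ℂ (X.space x)) (g : V)
    (x : X.Atom) (t : T) : colorSpace (relOfSpaces K) g x t = K g x t := by
  ext v
  rw [mem_colorSpace]
  constructor
  · rintro ⟨w, hw, e⟩
    rwa [bra_injective e]
  · exact fun hv => ⟨v, hv, rfl⟩

end QuantumSet

/-! ### Orthogonal projections in finite dimension -/

lemma hasSum_starProjection_of_iSup_eq_top {ι : Type u₁} {H : Type v₁} [NormedAddCommGroup H]
    [InnerProductSpace ℂ H] [FiniteDimensional ℂ H] {K : ι → Submodule ℂ H}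
    (hK : Pairwise fun i j => K i ⟂ K j) (htop : ⨆ i, K i = ⊤) (ξ : H) :
    HasSum (fun i => (K i).starProjection ξ) ξ := by
  have hξ : ξ ∈ ⨆ i, K i := htop ▸ Submodule.mem_top
  induction hξ using Submodule.iSup_induction' with
  | mem i x hx =>
    have h : (K i).starProjection x = x := Submodule.starProjection_eq_self_iff.2 hx
    have := hasSum_single (f := fun i => (K i).starProjection x) i fun j hj =>
      (Submodule.starProjection_apply_eq_zero_iff _).2 (hK hj.symm hx)
    rwa [h] at this
  | zero => simp
  | add x y _ _ hx hy => simpa using hx.add hy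

/-- Projections whose sum is the identity are mutually orthogonal. -/
lemma IsStarProjection.mul_eq_zero_of_hasSum {ι : Type u₁} {H : Type v₁} [NormedAddCommGroup H]
    [InnerProductSpace ℂ H] [FiniteDimensional ℂ H] {p : ι → H →ₗ[ℂ] H}
    (hp : ∀ i, IsStarProjection (p i)) (hsum : ∀ ξ, HasSum (fun i => p i ξ) ξ) {i j : ι}
    (hij : i ≠ j) : p i * p j = 0 := by
  have hpos : ∀ k (ξ : H), inner ℂ ξ (p k ξ) = ((‖p k ξ‖ ^ 2 : ℝ) : ℂ) := fun k ξ => by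
    have h1 : p k (p k ξ) = p k ξ := LinearMap.congr_fun (hp k).isIdempotentElem ξ
    have h2 : LinearMap.adjoint (p k) = p k := (hp k).isSelfAdjoint
    calc inner ℂ ξ (p k ξ) = inner ℂ ξ (p k (p k ξ)) := by rw [h1]
      _ = inner ℂ (p k ξ) (p k ξ) := by rw [← LinearMap.adjoint_inner_left, h2]
      _ = _ := by rw [inner_self_eq_norm_sq_to_K]; push_cast; rfl
  ext η
  set ξ := p j η with hξ
  have hξ' : p j ξ = ξ := LinearMap.congr_fun (hp j).isIdempotentElem η
  -- Since `‖ξ‖²` is the sum of all `‖p k ξ‖²` and the term `k = j` already equals `‖ξ‖²`, nothing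
  -- is left for `k = i`.
  have hs : HasSum (fun k => ‖p k ξ‖ ^ 2) (‖ξ‖ ^ 2) := by
    have := (hsum ξ).mapL (innerSL ℂ ξ)
    simp only [innerSL_apply_apply, hpos, inner_self_eq_norm_sq_to_K] at this
    have := this.mapL Complex.reCLM
    simpa [← Complex.ofReal_pow] using this
  classical
  have h2 := sum_le_hasSum ({i, j} : Finset ι) (fun k _ => sq_nonneg ‖p k ξ‖) hs
  rw [Finset.sum_pair hij, hξ'] at h2
  have h3 : ‖p i ξ‖ ^ 2 = 0 := le_antisymm (by linarith) (sq_nonneg _)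
  simpa using h3

lemma Submodule.isOrtho_range_iff_mul_eq_zero {H : Type v₁} [NormedAddCommGroup H]
    [InnerProductSpace ℂ H] [FiniteDimensional ℂ H] {p q : H →ₗ[ℂ] H}
    (hp : IsStarProjection p) : LinearMap.range p ⟂ LinearMap.range q ↔ p * q = 0 := by
  have h2 : LinearMap.adjoint p = p := hp.isSelfAdjoint
  rw [Submodule.isOrtho_iff_inner_eq]
  constructor
  · intro h
    ext ξ
    refine ext_inner_left ℂ fun η => ?_
    rw [Module.End.mul_apply, ← LinearMap.adjoint_inner_left, h2, LinearMap.zero_apply,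
      inner_zero_right]
    exact h _ ⟨η, rfl⟩ _ ⟨ξ, rfl⟩
  · rintro h _ ⟨η, rfl⟩ _ ⟨ξ, rfl⟩
    rw [← h2, LinearMap.adjoint_inner_left, ← Module.End.mul_apply, h, LinearMap.zero_apply,
      inner_zero_right]

lemma isStarProjection_coe_starProjection {H : Type v₁} [NormedAddCommGroup H]
    [InnerProductSpace ℂ H] [FiniteDimensional ℂ H] (K : Submodule ℂ H) :
    IsStarProjection (K.starProjection : H →ₗ[ℂ] H) := by
  constructor
  · ext ξ
    exact Submodule.starProjection_eq_self_iff.2 (Submodule.starProjection_apply_mem K ξ)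
  · refine (LinearMap.eq_adjoint_iff _ _).2 (fun x y => ?_) |>.symm
    exact Submodule.inner_starProjection_left_eq_right K x y

lemma IsStarProjection.eq_starProjection_range {H : Type v₁} [NormedAddCommGroup H]
    [InnerProductSpace ℂ H] [FiniteDimensional ℂ H] {p : H →ₗ[ℂ] H} (hp : IsStarProjection p) :
    ((LinearMap.range p).starProjection : H →ₗ[ℂ] H) = p := by
  have h2 : LinearMap.adjoint p = p := hp.isSelfAdjoint
  ext ξ
  refine Submodule.eq_starProjection_of_mem_of_inner_eq_zero ⟨ξ, rfl⟩ ?_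
  rintro _ ⟨η, rfl⟩
  have h1 : p (p ξ) = p ξ := LinearMap.congr_fun hp.isIdempotentElem ξ
  nth_rw 2 [← h2]
  rw [LinearMap.adjoint_inner_right, map_sub, h1, sub_self, inner_zero_left]

/-! ### Coloring families as projective colorings on each atom -/

namespace QuantumSet

variable {V : Type u₁} {T : Type u₂} {X : QuantumSet.{u₃, v₃}}

lemma adjoint_bra_comp_bra {H : Type v₁} [NormedAddCommGroup H] [InnerProductSpace ℂ H]
    [FiniteDimensional ℂ H] (v w : H) (z : ℂ ⊗[ℂ] H) :
    (LinearMap.adjoint (bra w) ∘ₗ bra v) z = (1 : ℂ) ⊗ₜ[ℂ] (bra v z • w) := by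
  rw [LinearMap.comp_apply, adjoint_bra, TensorProduct.tmul_smul, TensorProduct.smul_tmul',
    smul_eq_mul, mul_one]

lemma bra_comp_adjoint_bra {H : Type v₁} [NormedAddCommGroup H] [InnerProductSpace ℂ H]
    [FiniteDimensional ℂ H] (v w : H) :
    bra v ∘ₗ LinearMap.adjoint (bra w) = (inner ℂ v w : ℂ) • LinearMap.id := by
  ext
  rw [LinearMap.comp_apply, adjoint_bra]
  simp

/-- The generators of `F ∘ F†` are the scalars `⟪v, w⟫`; they are unconstrained on the diagonal and
must vanish between distinct colors. -/
lemma comp_adjoint_le_id_iff {F : Rel ((ofType V).prod X) (ofType T)} :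
    F.comp F.adjoint ≤ Rel.id (ofType T) ↔
      ∀ g x, Pairwise fun t t' => colorSpace F g x t ⟂ colorSpace F g x t' := by
  constructor
  · intro h g x t t' htt'
    rw [Submodule.isOrtho_iff_inner_eq]
    intro v hv w hw
    rw [mem_colorSpace] at hv hw
    have := h t' t (Submodule.subset_span ⟨(g, x), bra v, hv, _, ⟨bra w, hw, rfl⟩, rfl⟩)
    rw [Rel.id_apply_of_ne htt'.symm, Submodule.mem_bot] at this
    have h2 := LinearMap.congr_fun (bra_comp_adjoint_bra v w) 1
    erw [this] at h2
    simpa using h2.symm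
  · intro h t t'
    refine Submodule.span_le.2 ?_
    rintro _ ⟨⟨g, x⟩, s, hs, _, ⟨r, hr, rfl⟩, rfl⟩
    obtain ⟨v, rfl⟩ := exists_eq_bra s
    obtain ⟨w, rfl⟩ := exists_eq_bra r
    have e := bra_comp_adjoint_bra v w
    by_cases htt' : t = t'
    · subst htt'
      rw [Rel.id_apply]
      exact Submodule.mem_span_singleton.2 ⟨inner ℂ v w, e.symm⟩
    · have : inner ℂ v w = 0 := (Submodule.isOrtho_iff_inner_eq.1 (h g x (Ne.symm htt'))) v
        (mem_colorSpace.2 hs) w (mem_colorSpace.2 hr)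
      rw [this, zero_smul] at e
      erw [e]
      exact zero_mem _

/-- Every generator of `F† ∘ F` on an atom is an operator `|w⟩⟨v|` whose range lies in a color
space. If the identity is a combination of these, the color spaces span. -/
lemma iSup_colorSpace_eq_top {F : Rel ((ofType V).prod X) (ofType T)}
    (h : Rel.id ((ofType V).prod X) ≤ F.adjoint.comp F) (g : V) (x : X.Atom) :
    ⨆ t, colorSpace F g x t = ⊤ := by
  have key : ∀ a ∈ F.adjoint.comp F (g, x) (g, x), ∀ z,
      TensorProduct.lid ℂ (X.space x) (a z) ∈ ⨆ t, colorSpace F g x t := by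
    intro a ha
    induction ha using Submodule.span_induction with
    | zero => intro z; rw [LinearMap.zero_apply, map_zero]; exact zero_mem _
    | add a b _ _ ha hb =>
      intro z; rw [LinearMap.add_apply, map_add]; exact add_mem (ha z) (hb z)
    | smul c a _ ha =>
      intro z; rw [LinearMap.smul_apply, map_smul]; exact Submodule.smul_mem _ _ (ha z)
    | mem a ha =>
      obtain ⟨t, _, ⟨s, hs, rfl⟩, r, hr, rfl⟩ := ha
      intro z
      obtain ⟨w, rfl⟩ := exists_eq_bra s
      obtain ⟨v, rfl⟩ := exists_eq_bra r
      have := adjoint_bra_comp_bra v w z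
      erw [this]
      rw [TensorProduct.lid_tmul, one_smul]
      exact Submodule.smul_mem _ _
        ((le_iSup (colorSpace F g x) t) (mem_colorSpace.2 hs))
  refine eq_top_iff.2 fun ξ _ => ?_
  simpa using key _ (h _ _ (Rel.id_mem_id (X := (ofType V).prod X) (g, x))) ((1 : ℂ) ⊗ₜ ξ)

/-- With `P t` the projection onto the color space and `b` an orthonormal basis, `P t = ∑ i, |P t (b
i)⟩⟨P t (b i)|`, so `1 = ∑ t, P t` is a sum of generators of `F† ∘ F`. -/
lemma id_le_adjoint_comp {F : Rel ((ofType V).prod X) (ofType T)}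
    (hF : ∀ g x, Pairwise fun t t' => colorSpace F g x t ⟂ colorSpace F g x t')
    (htop : ∀ g x, ⨆ t, colorSpace F g x t = ⊤) :
    Rel.id ((ofType V).prod X) ≤ F.adjoint.comp F := by
  rintro ⟨g, x⟩ p'
  by_cases hp : (g, x) = p'
  · subst hp
    rw [Rel.id_apply, Submodule.span_singleton_le_iff_mem]
    -- A span contains only finite sums; independence in finite dimension leaves finitely many
    -- nonzero color spaces, even for infinite `T`.
    have hfin : {t | colorSpace F g x t ≠ ⊥}.Finite :=
      WellFoundedGT.finite_ne_bot_of_iSupIndep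
        (OrthogonalFamily.of_pairwise (hF g x)).independent
    let b := stdOrthonormalBasis ℂ (X.space x)
    have e : (LinearMap.id : ℂ ⊗[ℂ] X.space x →ₗ[ℂ] ℂ ⊗[ℂ] X.space x) =
        ∑ t ∈ hfin.toFinset, ∑ i,
          LinearMap.adjoint (bra ((colorSpace F g x t).starProjection (b i))) ∘ₗ
            bra ((colorSpace F g x t).starProjection (b i)) := by
      refine TensorProduct.ext' fun c ξ => ?_
      have h1 := (hasSum_starProjection_of_iSup_eq_top (hF g x) (htop g x) ξ).unique
        (hasSum_sum_of_ne_finset_zero (s := hfin.toFinset) fun t ht => by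
          have : colorSpace F g x t = ⊥ := by simpa using ht
          simp [this])
      have h2 : ∀ t, (colorSpace F g x t).starProjection ξ =
          ∑ i, (inner ℂ ((colorSpace F g x t).starProjection (b i)) ξ : ℂ) •
            (colorSpace F g x t).starProjection (b i) := fun t => by
        have h3 := congrArg (colorSpace F g x t).starProjection
          (b.sum_repr' ((colorSpace F g x t).starProjection ξ))
        rw [Submodule.starProjection_eq_self_iff.2
          (Submodule.starProjection_apply_mem (colorSpace F g x t) ξ)] at h3
        simpa only [map_sum, map_smul, ← Submodule.inner_starProjection_left_eq_right]
          using h3.symm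
      simp only [LinearMap.sum_apply, adjoint_bra_comp_bra, ← TensorProduct.tmul_sum, bra_tmul,
        mul_smul, ← Finset.smul_sum, ← h2, ← h1]
      rw [TensorProduct.tmul_smul, TensorProduct.smul_tmul', smul_eq_mul, mul_one]
      rfl
    erw [e]
    refine Submodule.sum_mem _ fun t _ => Submodule.sum_mem _ fun i _ => ?_
    have := mem_colorSpace.1 (Submodule.starProjection_apply_mem (colorSpace F g x t) (b i))
    exact Submodule.subset_span ⟨t, _, ⟨_, this, rfl⟩, _, this, rfl⟩
  · rw [Rel.id_apply_of_ne hp]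
    exact bot_le

lemma isFunction_iff {F : Rel ((ofType V).prod X) (ofType T)} : F.IsFunction ↔
    (∀ g x, Pairwise fun t t' => colorSpace F g x t ⟂ colorSpace F g x t') ∧
      ∀ g x, ⨆ t, colorSpace F g x t = ⊤ :=
  ⟨fun h => ⟨comp_adjoint_le_id_iff.1 h.2, iSup_colorSpace_eq_top h.1⟩,
    fun h => ⟨id_le_adjoint_comp h.1 h.2, comp_adjoint_le_id_iff.2 h.1⟩⟩

lemma isColoringFamily_iff {G : SimpleGraph V} {F : Rel ((ofType V).prod X) (ofType T)} :
    IsColoringFamily G X F ↔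
      ∀ x, IsProjectiveColoring G fun g t =>
        ((colorSpace F g x t).starProjection : X.space x →ₗ[ℂ] X.space x) := by
  have hr : ∀ (x : X.Atom) (K : Submodule ℂ (X.space x)),
      LinearMap.range (K.starProjection : X.space x →ₗ[ℂ] X.space x) = K := fun x K => by
    simp
  constructor
  · rintro ⟨h1, h2⟩ x
    rw [isFunction_iff] at h1
    refine ⟨fun g t => isStarProjection_coe_starProjection _, fun g ξ =>
      hasSum_starProjection_of_iSup_eq_top (h1.1 g x) (h1.2 g x) ξ, fun g₁ g₂ hg t => ?_⟩
    rw [← Submodule.isOrtho_range_iff_mul_eq_zero (isStarProjection_coe_starProjection _),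
      hr, hr]
    exact h2 g₁ g₂ hg t x
  · intro h
    refine ⟨isFunction_iff.2 ⟨fun g x t t' htt' => ?_, fun g x => ?_⟩, fun g₁ g₂ hg t x => ?_⟩
    · have := IsStarProjection.mul_eq_zero_of_hasSum ((h x).1 g) ((h x).2.1 g) htt'
      rwa [← Submodule.isOrtho_range_iff_mul_eq_zero (isStarProjection_coe_starProjection _),
        hr, hr] at this
    · refine eq_top_iff.2 fun ξ _ => ?_
      -- `ξ` is a limit of finite partial sums lying in a subspace that is closed.
      refine (Submodule.closed_of_finiteDimensional _).mem_of_tendsto ((h x).2.1 g ξ)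
        (Filter.Eventually.of_forall fun s => Submodule.sum_mem _ fun t _ => ?_)
      exact le_iSup (colorSpace F g x) t (Submodule.starProjection_apply_mem _ ξ)
    · have := (h x).2.2 g₁ g₂ hg t
      rwa [← Submodule.isOrtho_range_iff_mul_eq_zero (isStarProjection_coe_starProjection _),
        hr, hr] at this

lemma isColoringFamily_relOfSpaces {G : SimpleGraph V}
    {p : ∀ x : X.Atom, V → T → (X.space x →ₗ[ℂ] X.space x)}
    (hp : ∀ x, IsProjectiveColoring G (p x)) :
    IsColoringFamily G X (relOfSpaces fun g x t => LinearMap.range (p x g t)) := by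
  refine isColoringFamily_iff.2 fun x => ?_
  simp only [colorSpace_relOfSpaces, ((hp x).1 _ _).eq_starProjection_range]
  exact hp x

lemma bijOn_colorProjection (G : SimpleGraph V) (H : Type w₁) [NormedAddCommGroup H]
    [InnerProductSpace ℂ H] [FiniteDimensional ℂ H] [Nontrivial H] :
    Set.BijOn
      (fun F : Rel ((ofType V).prod (atomic H)) (ofType T) => colorProjection F)
      {F | IsColoringFamily G (atomic H) F}
      {p : V → T → (H →ₗ[ℂ] H) | IsProjectiveColoring G p} := by
  refine ⟨fun F hF => isColoringFamily_iff.1 hF (), fun F _ F' _ h => ?_, fun p hp => ?_⟩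
  · refine rel_ext_of_colorSpace fun g x t => ?_
    have := congrFun (congrFun h g) t
    have h2 := congrArg LinearMap.range this
    simp only [colorProjection, Submodule.range_starProjection] at h2
    exact h2
  · refine ⟨_, isColoringFamily_relOfSpaces (X := atomic H) (p := fun _ => p) fun _ => hp, ?_⟩
    funext g t
    rw [← (hp.1 g t).eq_starProjection_range]
    have := colorSpace_relOfSpaces (X := atomic H) (fun g _ t => LinearMap.range (p g t)) g () t
    exact congrArg (fun K : Submodule ℂ H => (K.starProjection : H →ₗ[ℂ] H)) this

end QuantumSet

/-! ### Transport of projective colorings between Hilbert spaces -/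

variable {V : Type u₁} {T : Type u₂}

lemma IsProjectiveColoring.conj {H : Type v₁} {K : Type v₂} [NormedAddCommGroup H]
    [InnerProductSpace ℂ H] [FiniteDimensional ℂ H] [NormedAddCommGroup K] [InnerProductSpace ℂ K]
    [FiniteDimensional ℂ K] {G : SimpleGraph V} {p : V → T → (H →ₗ[ℂ] H)}
    (hp : IsProjectiveColoring G p) (U : H ≃ₗᵢ[ℂ] K) :
    IsProjectiveColoring G fun g t => U.toLinearEquiv.conj (p g t) := by
  refine ⟨fun g t => ⟨?_, ?_⟩, fun g ξ => ?_, fun g₁ g₂ hg t => ?_⟩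
  · have := (hp.1 g t).isIdempotentElem
    rw [IsIdempotentElem, Module.End.mul_eq_comp] at *
    rw [← LinearEquiv.conj_comp, this]
  · have h := (LinearMap.isSymmetric_iff_isSelfAdjoint _).2 (hp.1 g t).isSelfAdjoint
    refine (LinearMap.isSymmetric_iff_isSelfAdjoint _).1 fun x y => ?_
    have := h (U.symm x) (U.symm y)
    rw [← U.inner_map_map, ← U.inner_map_map (U.symm x)] at this
    simpa [LinearEquiv.conj_apply] using this
  · have := (hp.2.1 g (U.symm ξ)).mapL (U.toContinuousLinearEquiv : H →L[ℂ] K)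
    simpa [LinearEquiv.conj_apply] using this
  · rw [Module.End.mul_eq_comp, ← LinearEquiv.conj_comp, ← Module.End.mul_eq_comp,
      hp.2.2 g₁ g₂ hg t, map_zero]

/-- The statements to be compared quantify over spaces in independent universes; a coordinate space,
followed by `ULift`, moves a coloring between them. The condition `n ≠ 0` keeps the space nonzero.
-/
lemma IsProjectiveColoring.exists_euclideanSpace {H : Type v₁} [NormedAddCommGroup H]
    [InnerProductSpace ℂ H] [FiniteDimensional ℂ H] [Nontrivial H] {G : SimpleGraph V}
    {p : V → T → (H →ₗ[ℂ] H)} (hp : IsProjectiveColoring G p) :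
    ∃ n : ℕ, n ≠ 0 ∧ ∃ q : V → T → (EuclideanSpace ℂ (Fin n) →ₗ[ℂ] EuclideanSpace ℂ (Fin n)),
      IsProjectiveColoring G q :=
  ⟨Module.finrank ℂ H, Module.finrank_pos.ne', _, hp.conj (stdOrthonormalBasis ℂ H).repr⟩

lemma IsProjectiveColoring.exists_ulift {n : ℕ} {G : SimpleGraph V}
    {p : V → T → (EuclideanSpace ℂ (Fin n) →ₗ[ℂ] EuclideanSpace ℂ (Fin n))}
    (hp : IsProjectiveColoring G p) :
    ∃ q : V → T → (EuclideanSpace ℂ (ULift.{v₁} (Fin n)) →ₗ[ℂ]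
      EuclideanSpace ℂ (ULift.{v₁} (Fin n))), IsProjectiveColoring G q :=
  ⟨_, hp.conj (LinearIsometryEquiv.piLpCongrLeft 2 ℂ ℂ Equiv.ulift.symm)⟩

/-! ### Positive operators, sums and contractions on tensor products -/

section Square

variable {A : Type v₁} {B : Type v₂} [NormedAddCommGroup A] [InnerProductSpace ℂ A]
  [NormedAddCommGroup B] [InnerProductSpace ℂ B]

lemma LinearMap.IsPositive.exists_adjoint_comp_self [FiniteDimensional ℂ A] {E : A →ₗ[ℂ] A} (hE : E.IsPositive) :
    ∃ S : A →ₗ[ℂ] A, E = LinearMap.adjoint S ∘ₗ S := by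
  have := FiniteDimensional.complete ℂ A
  have h : 0 ≤ LinearMap.toContinuousLinearMap E :=
    (ContinuousLinearMap.nonneg_iff_isPositive _).2
      ((LinearMap.isPositive_toContinuousLinearMap_iff E).2 hE)
  obtain ⟨S, hS⟩ := CStarAlgebra.nonneg_iff_eq_star_mul_self.1 h
  refine ⟨S.toLinearMap, LinearMap.ext fun ξ => ext_inner_right ℂ fun z => ?_⟩
  have h2 : E ξ = ContinuousLinearMap.adjoint S (S ξ) := by
    rw [← ContinuousLinearMap.star_eq_adjoint]
    exact DFunLike.congr_fun hS ξ
  rw [h2, ContinuousLinearMap.adjoint_inner_left, LinearMap.comp_apply,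
    LinearMap.adjoint_inner_left]
  rfl

/-- Writing `E ⊗ E' = (S ⊗ S')† (S ⊗ S')`, the inner product is `‖(S ⊗ S') z‖²`. -/
lemma LinearMap.IsPositive.map_apply_eq_zero [FiniteDimensional ℂ A]
    [FiniteDimensional ℂ B] {E : A →ₗ[ℂ] A} {E' : B →ₗ[ℂ] B}
    (hE : E.IsPositive) (hE' : E'.IsPositive) {z : A ⊗[ℂ] B}
    (h : (inner ℂ z (TensorProduct.map E E' z)).re = 0) : TensorProduct.map E E' z = 0 := by
  obtain ⟨S, rfl⟩ := hE.exists_adjoint_comp_self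
  obtain ⟨S', rfl⟩ := hE'.exists_adjoint_comp_self
  rw [TensorProduct.map_comp, ← TensorProduct.adjoint_map, LinearMap.comp_apply] at h ⊢
  rw [LinearMap.adjoint_inner_right] at h
  have : TensorProduct.map S S' z = 0 := by
    have h2 := inner_self_eq_norm_sq (𝕜 := ℂ) (TensorProduct.map S S' z)
    have h3 : ‖TensorProduct.map S S' z‖ ^ 2 = 0 := h2.symm.trans h
    simpa using h3
  rw [this, map_zero]

lemma HasSum.lTensor {ι : Type u₂} {E : ι → B →ₗ[ℂ] B} (hE : ∀ ξ, HasSum (fun t => E t ξ) ξ)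
    (z : A ⊗[ℂ] B) : HasSum (fun t => (E t).lTensor A z) z := by
  induction z with
  | zero => simp
  | tmul a b => simpa using (hE b).mapL (TensorProduct.mkL ℂ A B a)
  | add x y hx hy => simpa using hx.add hy

lemma HasSum.rTensor {ι : Type u₂} {E : ι → A →ₗ[ℂ] A} (hE : ∀ ξ, HasSum (fun t => E t ξ) ξ)
    (z : A ⊗[ℂ] B) : HasSum (fun t => (E t).rTensor B z) z := by
  induction z with
  | zero => simp
  | tmul a b => simpa using (hE a).mapL ((TensorProduct.mkL ℂ A B).flip b)
  | add x y hx hy => simpa using hx.add hy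

lemma HasSum.map_linearMap [FiniteDimensional ℂ A] {ι : Type u₂} {f : ι → A} {a : A} (h : HasSum f a) (L : A →ₗ[ℂ] B) :
    HasSum (fun i => L (f i)) (L a) :=
  h.mapL (LinearMap.toContinuousLinearMap L)

/-- Contraction of the second tensor factor of `z`; its range is the support of `z` on the first
factor. -/
noncomputable def TensorProduct.contractRight (z : A ⊗[ℂ] B) : (B →ₗ[ℂ] ℂ) →ₗ[ℂ] A :=
  (TensorProduct.rid ℂ A).toLinearMap ∘ₗ (LinearMap.lTensorHom A).flip z

lemma TensorProduct.contractRight_apply (z : A ⊗[ℂ] B) (φ : B →ₗ[ℂ] ℂ) :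
    contractRight z φ = TensorProduct.rid ℂ A (φ.lTensor A z) := rfl

lemma TensorProduct.contractRight_rTensor (E : A →ₗ[ℂ] A) (z : A ⊗[ℂ] B) (φ : B →ₗ[ℂ] ℂ) :
    contractRight (E.rTensor B z) φ = E (contractRight z φ) := by
  simp only [contractRight_apply]
  induction z with
  | zero => simp
  | tmul a b => simp
  | add x y hx hy => simp only [map_add, hx, hy]

lemma TensorProduct.contractRight_lTensor (E : B →ₗ[ℂ] B) (z : A ⊗[ℂ] B) (φ : B →ₗ[ℂ] ℂ) :
    contractRight (E.lTensor A z) φ = contractRight z (φ ∘ₗ E) := by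
  simp only [contractRight_apply, LinearMap.lTensor_comp_apply]

lemma TensorProduct.contractRight_zero : contractRight (0 : A ⊗[ℂ] B) = 0 := by
  simp [contractRight]

/-- Contracting with `⟪b, ·⟫` and pairing with `a` gives `⟪a ⊗ b, z⟫`, and product vectors separate
points. -/
lemma TensorProduct.eq_zero_of_contractRight_eq_zero {z : A ⊗[ℂ] B} (h : contractRight z = 0) :
    z = 0 := by
  refine TensorProduct.ext_iff_inner_left.2 fun a b => ?_
  have key : ∀ z : A ⊗[ℂ] B,
      inner ℂ (a ⊗ₜ[ℂ] b) z = inner ℂ a (contractRight z (innerₛₗ ℂ b)) := fun z => by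
    simp only [contractRight_apply]
    induction z with
    | zero => simp
    | tmul x y => simp [mul_comm]
    | add x y hx hy => simp only [map_add, inner_add_right, hx, hy]
  rw [key, h, LinearMap.zero_apply, inner_zero_right, inner_zero_right]

end Square

/-! ### From a winning strategy to a projective coloring -/

section Strategy

variable {A : Type v₁} {B : Type v₂} [NormedAddCommGroup A] [InnerProductSpace ℂ A]
  [FiniteDimensional ℂ A] [NormedAddCommGroup B] [InnerProductSpace ℂ B] [FiniteDimensional ℂ B]
  {σ : EntangledStrategy V T A B} {G : SimpleGraph V}

namespace EntangledStrategy

lemma IsWinning.map_state_eq_zero (h : σ.IsWinning G) {g₁ g₂ : V} {t₁ t₂ : T}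
    (hl : ¬ G.ColoringGameWins g₁ g₂ t₁ t₂) :
    TensorProduct.map ((σ.alice g₁).effect t₁) ((σ.bob g₂).effect t₂) σ.state = 0 :=
  ((σ.alice g₁).isPositive t₁).map_apply_eq_zero ((σ.bob g₂).isPositive t₂)
    (not_not.1 fun h' => hl (h _ _ _ _ h'))

/-- Insert `1 = ∑ t', E'_gt'` on Bob's side: for equal questions every term with `t' ≠ t` is a
losing pair and annihilates the state. -/
lemma IsWinning.rTensor_state (h : σ.IsWinning G) (g : V) (t : T) :
    ((σ.alice g).effect t).rTensor B σ.state =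
      TensorProduct.map ((σ.alice g).effect t) ((σ.bob g).effect t) σ.state := by
  refine ((HasSum.lTensor (A := A) (σ.bob g).hasSum σ.state).map_linearMap
    (((σ.alice g).effect t).rTensor B)).unique ?_
  simp only [← LinearMap.comp_apply, LinearMap.rTensor_comp_lTensor]
  exact hasSum_single t fun t' ht => h.map_state_eq_zero fun hw => ht (hw.1 rfl).symm

lemma IsWinning.lTensor_state (h : σ.IsWinning G) (g : V) (t : T) :
    ((σ.bob g).effect t).lTensor A σ.state =
      TensorProduct.map ((σ.alice g).effect t) ((σ.bob g).effect t) σ.state := by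
  refine ((HasSum.rTensor (B := B) (σ.alice g).hasSum σ.state).map_linearMap
    (((σ.bob g).effect t).lTensor A)).unique ?_
  simp only [← LinearMap.comp_apply, LinearMap.lTensor_comp_rTensor]
  exact hasSum_single t fun t' ht => h.map_state_eq_zero fun hw => ht (hw.1 rfl)

/-- Trading the inner operator for Bob's turns a product of two operators of Alice into a joint
measurement. It yields idempotence for `g₁ = g₂` and a zero product for adjacent vertices. -/
lemma IsWinning.rTensor_rTensor_state (h : σ.IsWinning G) (g₁ g₂ : V) (t : T) :
    ((σ.alice g₁).effect t).rTensor B (((σ.alice g₂).effect t).rTensor B σ.state) =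
      TensorProduct.map ((σ.alice g₁).effect t) ((σ.bob g₂).effect t) σ.state := by
  rw [h.rTensor_state g₂, ← h.lTensor_state g₂, ← LinearMap.comp_apply,
    LinearMap.rTensor_comp_lTensor]

/-- On the state Alice's operator equals Bob's, and Bob's is absorbed into the functional used for
the contraction. -/
lemma IsWinning.mapsTo_support (h : σ.IsWinning G) (g : V) (t : T) :
    ∀ ξ ∈ LinearMap.range (TensorProduct.contractRight σ.state),
      (σ.alice g).effect t ξ ∈ LinearMap.range (TensorProduct.contractRight σ.state) := by
  rintro _ ⟨φ, rfl⟩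
  rw [← TensorProduct.contractRight_rTensor, h.rTensor_state, ← h.lTensor_state,
    TensorProduct.contractRight_lTensor]
  exact ⟨_, rfl⟩

lemma IsWinning.isProjectiveColoring (h : σ.IsWinning G) :
    IsProjectiveColoring G fun g t => ((σ.alice g).effect t).restrict (h.mapsTo_support g t) := by
  refine ⟨fun g t => ⟨?_, ?_⟩, fun g ξ => ?_, fun g₁ g₂ hg t => ?_⟩
  · refine LinearMap.ext ?_
    rintro ⟨_, φ, rfl⟩
    refine Subtype.ext ?_
    simp only [Module.End.mul_apply, LinearMap.coe_restrict_apply]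
    rw [← TensorProduct.contractRight_rTensor, ← TensorProduct.contractRight_rTensor,
      h.rTensor_rTensor_state, ← h.rTensor_state]
  · exact (LinearMap.isSymmetric_iff_isSelfAdjoint _).1
      (((σ.alice g).isPositive t).isSymmetric.restrict_invariant (h.mapsTo_support g t))
  · refine (Topology.IsInducing.subtypeVal.hasSum_iff (g := (Submodule.subtype _).toAddMonoidHom) _ _).1 ?_
    exact (σ.alice g).hasSum ξ
  · refine LinearMap.ext ?_
    rintro ⟨_, φ, rfl⟩
    refine Subtype.ext ?_
    simp only [Module.End.mul_apply, LinearMap.coe_restrict_apply]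
    rw [← TensorProduct.contractRight_rTensor, ← TensorProduct.contractRight_rTensor,
      h.rTensor_rTensor_state, h.map_state_eq_zero fun hw => hw.2 hg rfl,
      TensorProduct.contractRight_zero]
    rfl

variable (σ) in
lemma nontrivial_support :
    Nontrivial (LinearMap.range (TensorProduct.contractRight σ.state)) := by
  rw [Submodule.nontrivial_iff_ne_bot, ne_eq, LinearMap.range_eq_bot]
  intro h
  have := σ.norm_state
  rw [TensorProduct.eq_zero_of_contractRight_eq_zero h, norm_zero] at this
  exact zero_ne_one this

end EntangledStrategy

end Strategy

/-! ### From a projective coloring to a winning strategy -/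

section Transpose

variable {ι : Type u₃} [Fintype ι] [DecidableEq ι]
  {A : Type v₁} {B : Type v₂} [NormedAddCommGroup A] [InnerProductSpace ℂ A]
  [NormedAddCommGroup B] [InnerProductSpace ℂ B]
  (a : OrthonormalBasis ι ℂ A) (b : OrthonormalBasis ι ℂ B)

/-- The operator on `B` whose matrix in the basis `b` is the transpose of the matrix of `p` in the
basis `a`. -/
noncomputable def transposeOperator (p : A →ₗ[ℂ] A) : B →ₗ[ℂ] B :=
  Matrix.toLin b.toBasis b.toBasis (LinearMap.toMatrix a.toBasis a.toBasis p).transpose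

lemma transposeOperator_basis (p : A →ₗ[ℂ] A) (i : ι) :
    transposeOperator a b p (b i) = ∑ j, (inner ℂ (a i) (p (a j)) : ℂ) • b j := by
  have := Matrix.toLin_self b.toBasis b.toBasis
    (LinearMap.toMatrix a.toBasis a.toBasis p).transpose i
  simpa [transposeOperator, LinearMap.toMatrix_apply, a.repr_apply_apply] using this

lemma transposeOperator_apply (p : A →ₗ[ℂ] A) (ξ : B) :
    transposeOperator a b p ξ =
      ∑ i, ∑ j, ((inner ℂ (b i) ξ : ℂ) * inner ℂ (a i) (p (a j))) • b j := by
  conv_lhs => rw [← b.sum_repr' ξ]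
  simp [transposeOperator_basis, Finset.smul_sum, mul_smul]

lemma transposeOperator_id : transposeOperator a b LinearMap.id = LinearMap.id := by
  rw [transposeOperator, LinearMap.toMatrix_id, Matrix.transpose_one, Matrix.toLin_one]

lemma transposeOperator_mul (p q : A →ₗ[ℂ] A) : transposeOperator a b (p * q) =
    transposeOperator a b q * transposeOperator a b p := by
  simp only [transposeOperator]
  rw [LinearMap.toMatrix_mul, Matrix.transpose_mul, Matrix.toLin_mul b.toBasis b.toBasis b.toBasis]
  rfl

lemma isPositive_transposeOperator [FiniteDimensional ℂ A] {p : A →ₗ[ℂ] A} (hp : IsStarProjection p) :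
    (transposeOperator a b p).IsPositive := by
  refine LinearMap.IsSymmetricProjection.isPositive ⟨?_, ?_⟩
  · rw [IsIdempotentElem, ← transposeOperator_mul, hp.isIdempotentElem.eq]
  · have h := (LinearMap.isSymmetric_iff_isSelfAdjoint _).2 hp.isSelfAdjoint
    intro x y
    simp only [transposeOperator_apply, sum_inner, inner_sum, inner_smul_left, inner_smul_right,
      map_mul, inner_conj_symm]
    rw [Finset.sum_comm]
    refine Finset.sum_congr rfl fun i _ => Finset.sum_congr rfl fun j _ => ?_
    rw [h]
    ring

lemma hasSum_transposeOperator {p : T → A →ₗ[ℂ] A} (hp : ∀ ξ, HasSum (fun t => p t ξ) ξ) (ξ : B) :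
    HasSum (fun t => transposeOperator a b (p t) ξ) ξ := by
  -- Expanding `ξ` as the transpose of the identity reduces convergence to the finitely many matrix
  -- entries.
  have h := transposeOperator_apply a b LinearMap.id ξ
  rw [transposeOperator_id, LinearMap.id_apply] at h
  conv => enter [2]; rw [h]
  simp only [transposeOperator_apply]
  exact hasSum_sum fun i _ => hasSum_sum fun j _ =>
    (((hp (a j)).mapL (innerSL ℂ (a i))).mul_left _).smul_const _

/-- Both sides are the double sum of `⟪a i, p (a j)⟫ • (a i ⊗ b j)`: on the maximally entangled
vector an operator can be moved to the other factor by transposing it. -/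
lemma lTensor_transposeOperator (p : A →ₗ[ℂ] A) :
    (transposeOperator a b p).lTensor A (∑ i, a i ⊗ₜ[ℂ] b i) =
      p.rTensor B (∑ i, a i ⊗ₜ[ℂ] b i) := by
  simp only [map_sum, LinearMap.lTensor_tmul, LinearMap.rTensor_tmul, transposeOperator_basis,
    TensorProduct.tmul_sum, TensorProduct.tmul_smul]
  rw [Finset.sum_comm]
  refine Finset.sum_congr rfl fun j _ => ?_
  conv_rhs => rw [← a.sum_repr' (p (a j))]
  simp [TensorProduct.sum_tmul, TensorProduct.smul_tmul']

lemma sum_tmul_ne_zero [Nonempty ι] : (∑ i, a i ⊗ₜ[ℂ] b i) ≠ 0 := by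
  intro h
  obtain ⟨k⟩ := ‹Nonempty ι›
  have := congrArg (fun z => inner ℂ (a k ⊗ₜ[ℂ] b k) z) h
  simp [inner_sum, orthonormal_iff_ite.1 a.orthonormal, orthonormal_iff_ite.1 b.orthonormal] at this

variable [FiniteDimensional ℂ A] [FiniteDimensional ℂ B]

/-- The strategy in which the players share a maximally entangled state, one of them measures the
given projections, and the other one their transposes. -/
noncomputable def IsProjectiveColoring.strategy [Nonempty ι] {G : SimpleGraph V}
    {p : V → T → (A →ₗ[ℂ] A)} (hp : IsProjectiveColoring G p) : EntangledStrategy V T A B where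
  state := ((‖∑ i, a i ⊗ₜ[ℂ] b i‖⁻¹ : ℝ) : ℂ) • ∑ i, a i ⊗ₜ[ℂ] b i
  norm_state := by
    have := norm_ne_zero_iff.2 (sum_tmul_ne_zero a b)
    rw [norm_smul, Complex.norm_real, norm_inv, norm_norm, inv_mul_cancel₀ this]
  alice g := ⟨p g, fun t => ((LinearMap.isStarProjection_iff_isSymmetricProjection).1
    (hp.1 g t)).isPositive, hp.2.1 g⟩
  bob g := ⟨fun t => transposeOperator a b (p g t), fun t => isPositive_transposeOperator a b
    (hp.1 g t), hasSum_transposeOperator a b (hp.2.1 g)⟩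

/-- Moving the transpose across gives `(p g₁ t₁ * p g₂ t₂) ⊗ 1` on the state, and this product
vanishes for every losing pair: by orthogonality of the projections at one vertex, or by the
coloring condition. -/
lemma IsProjectiveColoring.isWinning_strategy [Nonempty ι] {G : SimpleGraph V}
    {p : V → T → (A →ₗ[ℂ] A)} (hp : IsProjectiveColoring G p) :
    (hp.strategy a b).IsWinning G := by
  have key : ∀ g₁ g₂ t₁ t₂, p g₁ t₁ * p g₂ t₂ = 0 → (hp.strategy a b).prob g₁ g₂ t₁ t₂ = 0 := by
    intro g₁ g₂ t₁ t₂ h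
    have e : TensorProduct.map (p g₁ t₁) (transposeOperator a b (p g₂ t₂))
        (∑ i, a i ⊗ₜ[ℂ] b i) = 0 := by
      rw [← LinearMap.rTensor_comp_lTensor, LinearMap.comp_apply, lTensor_transposeOperator,
        ← LinearMap.comp_apply, ← LinearMap.rTensor_comp, ← Module.End.mul_eq_comp, h]
      simp
    simp [EntangledStrategy.prob, IsProjectiveColoring.strategy, -map_sum, e]
  refine fun g₁ g₂ t₁ t₂ h => ⟨fun hg => ?_, fun hg ht => ?_⟩
  · subst hg
    by_contra ht
    exact h (key _ _ _ _ (IsStarProjection.mul_eq_zero_of_hasSum (hp.1 g₁) (hp.2.1 g₁) ht))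
  · subst ht
    exact h (key _ _ _ _ (hp.2.2 g₁ g₂ hg t₁))

end Transpose

theorem mainTheorem11 {V : Type u₁} {T : Type u₂} (G : SimpleGraph V) :
    List.TFAE [
      ∃ (A : Type v₁) (B : Type v₂)
        (_ : NormedAddCommGroup A) (_ : InnerProductSpace ℂ A) (_ : FiniteDimensional ℂ A)
        (_ : NormedAddCommGroup B) (_ : InnerProductSpace ℂ B) (_ : FiniteDimensional ℂ B)
        (σ : EntangledStrategy V T A B), σ.IsWinning G,
      ∃ X : QuantumSet.{u₃, v₃}, Nonempty X.Atom ∧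
        ∃ F : QuantumSet.Rel ((QuantumSet.ofType V).prod X) (QuantumSet.ofType T),
          QuantumSet.IsColoringFamily G X F,
      ∃ (H : Type w₁) (_ : NormedAddCommGroup H) (_ : InnerProductSpace ℂ H)
        (_ : FiniteDimensional ℂ H) (_ : Nontrivial H)
        (F : QuantumSet.Rel ((QuantumSet.ofType V).prod (QuantumSet.atomic H))
          (QuantumSet.ofType T)),
          QuantumSet.IsColoringFamily G (QuantumSet.atomic H) F] ∧
    ∀ (H : Type w₁) [NormedAddCommGroup H] [InnerProductSpace ℂ H]
      [FiniteDimensional ℂ H] [Nontrivial H],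
      Set.BijOn
        (fun F : QuantumSet.Rel ((QuantumSet.ofType V).prod (QuantumSet.atomic H))
          (QuantumSet.ofType T) => QuantumSet.colorProjection F)
        {F | QuantumSet.IsColoringFamily G (QuantumSet.atomic H) F}
        {p : V → T → (H →ₗ[ℂ] H) | IsProjectiveColoring G p} := by
  refine ⟨?_, fun H _ _ _ _ => QuantumSet.bijOn_colorProjection G H⟩
  tfae_have 1 → 3 := by
    rintro ⟨A, B, _, _, _, _, _, _, σ, hσ⟩
    have := σ.nontrivial_support
    obtain ⟨n, hn, p, hp⟩ := hσ.isProjectiveColoring.exists_euclideanSpace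
    obtain ⟨q, hq⟩ := hp.exists_ulift
    have : NeZero n := ⟨hn⟩
    exact ⟨EuclideanSpace ℂ (ULift (Fin n)), inferInstance, inferInstance, inferInstance,
      inferInstance, _, QuantumSet.isColoringFamily_relOfSpaces (X := QuantumSet.atomic _)
        (p := fun _ => q) fun _ => hq⟩
  tfae_have 3 → 2 := by
    rintro ⟨H, _, _, _, _, F, hF⟩
    obtain ⟨n, hn, p, hp⟩ :=
      (QuantumSet.isColoringFamily_iff.1 hF ()).exists_euclideanSpace
    obtain ⟨q, hq⟩ := hp.exists_ulift
    have : NeZero n := ⟨hn⟩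
    let X : QuantumSet.{u₃, v₃} :=
      { Atom := PUnit, space := fun _ => EuclideanSpace ℂ (ULift (Fin n)) }
    exact ⟨X, ⟨PUnit.unit⟩, _, QuantumSet.isColoringFamily_relOfSpaces (X := X)
        (p := fun _ => q) fun _ => hq⟩
  tfae_have 2 → 1 := by
    -- Any single atom of `X` carries a projective coloring.
    rintro ⟨X, ⟨x⟩, F, hF⟩
    obtain ⟨n, hn, p, hp⟩ :=
      (QuantumSet.isColoringFamily_iff.1 hF x).exists_euclideanSpace
    obtain ⟨q, hq⟩ := hp.exists_ulift
    have : NeZero n := ⟨hn⟩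
    exact ⟨EuclideanSpace ℂ (ULift (Fin n)), EuclideanSpace ℂ (ULift (Fin n)), inferInstance,
      inferInstance, inferInstance, inferInstance, inferInstance, inferInstance, _,
      hq.isWinning_strategy ((EuclideanSpace.basisFun _ ℂ).reindex Equiv.ulift)
        ((EuclideanSpace.basisFun _ ℂ).reindex Equiv.ulift)⟩
  tfae_finish
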